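/- **Setting.** Let $G$ be a finite group. A representation of dimension $d\ge 1$ is a homomorphism $\phi:G\to \mathrm{GL}_d(\mathbb C)$; two representations are isomorphic if they differ by a change of basis, and $\bar\phi$ denotes the entrywise complex conjugate of $\phi$. Call $\phi$ *self-conjugate* if $\phi\cong\bar\phi$, and *basic self-conjugate* (bsc) if it is self-conjugate and not isomorphic to a direct sum of two self-conjugate representations (of positive dimension). Call $\phi$ *real* if it is isomorphic to a representation with real matrix entries, and *quaternionic* if it is self-conjugate but not real. A bsc $\phi$ has *type I* if it is real and irreducible; *type II* if it is real and isomorphic to $\psi\oplus\bar\psi$ for some irreducible $\psi$ that is not self-conjugate; *type III* if it is quaternionic and irreducible. Let $R_\phi\subseteq\mathbb R^G$ be the real span of the real and imaginary parts of all matrix entries $g\mapsto\phi(g)_{i,j}$. Let $$\delta_G=\sum_{a,b\in G}1_a\otimes 1_b\otimes 1_{ab}\in(\mathbb R^G)^{\otimes 3},$$ and let $\delta_{G,\phi^{\otimes 3}}$ be the orthogonal projection of $\delta_G$ onto $R_\phi\otimes R_\phi\otimes R_\phi$ with respect to the inner product on $(\mathbb R^G)^{\otimes 3}$ induced by the Euclidean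 inner product of $\mathbb R^G$. The rank of a real $3$-tensor in $V_1\otimes V_2\otimes V_3$ is the least $N$ such that it is a sum of $N$ pure tensors $v_1\otimes v_2\otimes v_3$. Let $m_d$ be the rank of the tensor of multiplication of real $d\times d$ matrices, $$\sum_{i,j,k=1}^d E_{ij}\otimes E_{jk}\otimes e_{ik}\in M_d(\mathbb R)^*\otimes M_d(\mathbb R)^*\otimes M_d(\mathbb R),$$ where $E_{ij}$ is the functional $M\mapsto M_{ij}$ and $e_{ik}$ is the elementary matrix. **Proposition.** Let $\phi$ be a bsc of $G$ of dimension $d=d_\phi$. If $\phi$ is of type II or III, then $d$ is even, and $$\mathrm{rank}\big(\delta_{G,\phi^{\otimes 3}}\big)\le\begin{cases} m_d,&\phi\text{ of type I},\\ 3\,m_{d/2},&\phi\text{ of type II},\\ 8\,m_{d/2},&\phi\text{ of type III}.\end{cases}$$ -/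

import Mathlib

open scoped TensorProduct

namespace BscTensor

/-! ### Tensor rank -/

section Rank

variable {V₁ V₂ V₃ : Type*} [AddCommGroup V₁] [AddCommGroup V₂] [AddCommGroup V₃]
  [Module ℝ V₁] [Module ℝ V₂] [Module ℝ V₃]

/-- `T` is a sum of `N` pure tensors `u ⊗ v ⊗ w`. -/
def IsSumOfPure (T : V₁ ⊗[ℝ] (V₂ ⊗[ℝ] V₃)) (N : ℕ) : Prop :=
  ∃ (u : Fin N → V₁) (v : Fin N → V₂) (w : Fin N → V₃),
    T = ∑ i, u i ⊗ₜ[ℝ] (v i ⊗ₜ[ℝ] w i)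

/-- The rank of a real `3`-tensor: the least number of pure tensors that sum to it. -/
noncomputable def tensorRank (T : V₁ ⊗[ℝ] (V₂ ⊗[ℝ] V₃)) : ℕ :=
  sInf {N : ℕ | IsSumOfPure T N}

theorem IsSumOfPure.add {S T : V₁ ⊗[ℝ] (V₂ ⊗[ℝ] V₃)} {M N : ℕ}
    (hS : IsSumOfPure S M) (hT : IsSumOfPure T N) : IsSumOfPure (S + T) (M + N) := by
  obtain ⟨u, v, w, rfl⟩ := hS
  obtain ⟨u', v', w', rfl⟩ := hT
  exact ⟨Fin.append u u', Fin.append v v', Fin.append w w', by simp [Fin.sum_univ_add]⟩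

/-- The set in the definition of `tensorRank` is never empty, so the infimum is a minimum. -/
theorem exists_isSumOfPure (T : V₁ ⊗[ℝ] (V₂ ⊗[ℝ] V₃)) : ∃ N, IsSumOfPure T N := by
  induction T with
  | zero => exact ⟨0, Fin.elim0, Fin.elim0, Fin.elim0, by simp⟩
  | tmul x y =>
    induction y with
    | zero => exact ⟨0, Fin.elim0, Fin.elim0, Fin.elim0, by simp⟩
    | tmul y z => exact ⟨1, fun _ => x, fun _ => y, fun _ => z, by simp⟩
    | add y z hy hz =>
      obtain ⟨M, hM⟩ := hy
      obtain ⟨N, hN⟩ := hz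
      exact ⟨M + N, by rw [TensorProduct.tmul_add]; exact hM.add hN⟩
  | add S T hS hT =>
    obtain ⟨M, hM⟩ := hS
    obtain ⟨N, hN⟩ := hT
    exact ⟨M + N, hM.add hN⟩

theorem isSumOfPure_tensorRank (T : V₁ ⊗[ℝ] (V₂ ⊗[ℝ] V₃)) : IsSumOfPure T (tensorRank T) :=
  Nat.sInf_mem (exists_isSumOfPure T)

end Rank

/-! ### The matrix multiplication tensor -/

/-- The tensor `∑ E_{ij} ⊗ E_{jk} ⊗ e_{ik}` in `M_d^* ⊗ M_d^* ⊗ M_d` of the multiplication of real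
`d × d` matrices: `E_{ij}` is the functional reading off the `(i, j)` entry and `e_{ik}` is the
elementary matrix. -/
noncomputable def matMulTensor (d : ℕ) :
    Module.Dual ℝ (Matrix (Fin d) (Fin d) ℝ) ⊗[ℝ]
      (Module.Dual ℝ (Matrix (Fin d) (Fin d) ℝ) ⊗[ℝ] Matrix (Fin d) (Fin d) ℝ) :=
  ∑ i : Fin d, ∑ j : Fin d, ∑ k : Fin d,
    Matrix.entryLinearMap ℝ ℝ i j ⊗ₜ[ℝ]
      (Matrix.entryLinearMap ℝ ℝ j k ⊗ₜ[ℝ] Matrix.single i k (1 : ℝ))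

/-- `m_d`: the tensor rank of the multiplication of real `d × d` matrices. -/
noncomputable def matMulRank (d : ℕ) : ℕ := tensorRank (matMulTensor d)

/-! ### Complex matrix representations -/

/-- A complex matrix representation of `G`, with rows and columns indexed by `n`. -/
abbrev MatRep (G : Type*) [Group G] (n : Type*) [Fintype n] [DecidableEq n] :=
  G →* Matrix.GeneralLinearGroup n ℂ

section Rep

variable {G : Type*} [Group G] {m n : Type*} [Fintype m] [DecidableEq m] [Fintype n]
  [DecidableEq n]

/-- `φ` and `ψ` are isomorphic (versions of each other): they differ by an invertible change of
basis `P`, with inverse `Q`. -/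
def Isomorphic (φ : MatRep G m) (ψ : MatRep G n) : Prop :=
  ∃ (P : Matrix m n ℂ) (Q : Matrix n m ℂ), P * Q = 1 ∧ Q * P = 1 ∧
    ∀ g, (φ g : Matrix m m ℂ) = P * (ψ g : Matrix n n ℂ) * Q

/-- The entrywise complex conjugate of a representation. -/
noncomputable def conjRep (φ : MatRep G n) : MatRep G n :=
  (Matrix.GeneralLinearGroup.map (starRingEnd ℂ)).comp φ

/-- The underlying block diagonal matrices of the direct sum of two representations. -/
def directSumHom (φ : MatRep G m) (ψ : MatRep G n) : G →* Matrix (m ⊕ n) (m ⊕ n) ℂ where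
  toFun g := Matrix.fromBlocks (φ g : Matrix m m ℂ) 0 0 (ψ g : Matrix n n ℂ)
  map_one' := by simp
  map_mul' g h := by simp [Matrix.fromBlocks_multiply]

/-- The direct sum of two representations. -/
def directSum (φ : MatRep G m) (ψ : MatRep G n) : MatRep G (m ⊕ n) :=
  (directSumHom φ ψ).toHomUnits

/-- Self-conjugate: isomorphic to the conjugate representation. -/
def IsSelfConj (φ : MatRep G n) : Prop := Isomorphic φ (conjRep φ)

/-- Basic self-conjugate (bsc): a self-conjugate representation of positive dimension that is not
isomorphic to the direct sum of two self-conjugate representations (of positive dimension). -/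
def IsBsc (φ : MatRep G n) : Prop :=
  0 < Fintype.card n ∧ IsSelfConj φ ∧
    ¬ ∃ (k l : ℕ) (ψ : MatRep G (Fin k)) (ξ : MatRep G (Fin l)),
      0 < k ∧ 0 < l ∧ IsSelfConj ψ ∧ IsSelfConj ξ ∧ Isomorphic φ (directSum ψ ξ)

/-- The linear representation on `ℂⁿ` given by a matrix representation. -/
noncomputable def toRep (φ : MatRep G n) : Representation ℂ G (n → ℂ) :=
  ((Matrix.toLinAlgEquiv' : Matrix n n ℂ ≃ₐ[ℂ] _) : Matrix n n ℂ →* ((n → ℂ) →ₗ[ℂ] (n → ℂ))).comp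
    ((Units.coeHom (Matrix n n ℂ)).comp φ)

/-- Irreducible: nonzero and without proper nonzero invariant subspaces. -/
def IsIrred (φ : MatRep G n) : Prop := (toRep φ).IsIrreducible

/-- Real: isomorphic to a representation whose matrix entries are real. -/
def IsReal (φ : MatRep G n) : Prop :=
  ∃ ψ : MatRep G n, Isomorphic φ ψ ∧ ∀ g i j, ((ψ g : Matrix n n ℂ) i j).im = 0

/-- Quaternionic: self-conjugate but not real. -/
def IsQuaternionic (φ : MatRep G n) : Prop := IsSelfConj φ ∧ ¬ IsReal φ

/-- Type I: real and irreducible. -/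
def IsTypeI (φ : MatRep G n) : Prop := IsReal φ ∧ IsIrred φ

/-- Type II: real, and isomorphic to `ψ ⊕ ψ̄` for an irreducible `ψ` that is complex, that is, not
self-conjugate. -/
def IsTypeII (φ : MatRep G n) : Prop :=
  IsReal φ ∧ ∃ (k : ℕ) (ψ : MatRep G (Fin k)),
    IsIrred ψ ∧ ¬ IsSelfConj ψ ∧ Isomorphic φ (directSum ψ (conjRep ψ))

/-- Type III: quaternionic and irreducible. -/
def IsTypeIII (φ : MatRep G n) : Prop := IsQuaternionic φ ∧ IsIrred φ

end Rep

/-! ### Matrix coefficients and the projected multiplication tensor of a finite group -/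

section Tensor

variable {G : Type*} [Group G] [Fintype G] {n : Type*} [Fintype n] [DecidableEq n]

/-- The space `R_φ ⊆ ℝ^G` spanned by the real and imaginary parts of the matrix entries of `φ`. -/
noncomputable def coeffSpace (φ : MatRep G n) : Submodule ℝ (EuclideanSpace ℝ G) :=
  Submodule.span ℝ
    ({v | ∃ i j, v = WithLp.toLp 2 fun g => ((φ g : Matrix n n ℂ) i j).re} ∪
      {v | ∃ i j, v = WithLp.toLp 2 fun g => ((φ g : Matrix n n ℂ) i j).im})

/-- The order three tensors on `ℝ^G`, with the inner product for which
`⟪u ⊗ v ⊗ w, u' ⊗ v' ⊗ w'⟫ = ⟪u, u'⟫ ⟪v, v'⟫ ⟪w, w'⟫`. -/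
abbrev Tensor3 (G : Type*) [Fintype G] :=
  EuclideanSpace ℝ G ⊗[ℝ] (EuclideanSpace ℝ G ⊗[ℝ] EuclideanSpace ℝ G)

/-- The subspace `R ⊗ R ⊗ R` of `ℝ^G ⊗ ℝ^G ⊗ ℝ^G`. -/
def tensorCube (R : Submodule ℝ (EuclideanSpace ℝ G)) : Submodule ℝ (Tensor3 G) :=
  Submodule.span ℝ {T | ∃ u ∈ R, ∃ v ∈ R, ∃ w ∈ R, T = u ⊗ₜ[ℝ] (v ⊗ₜ[ℝ] w)}

/-- The multiplication tensor `δ_G = ∑ 1_a ⊗ 1_b ⊗ 1_{ab}`. -/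
noncomputable def groupTensor (G : Type*) [Group G] [Fintype G] [DecidableEq G] : Tensor3 G :=
  ∑ a : G, ∑ b : G, EuclideanSpace.single a (1 : ℝ) ⊗ₜ[ℝ]
    (EuclideanSpace.single b (1 : ℝ) ⊗ₜ[ℝ] EuclideanSpace.single (a * b) (1 : ℝ))

/-- `δ_{G, φ^{⊗3}}`: the orthogonal projection of `δ_G` onto `R_φ ⊗ R_φ ⊗ R_φ`. -/
noncomputable def projGroupTensor [DecidableEq G] (φ : MatRep G n) : Tensor3 G :=
  Submodule.starProjection (𝕜 := ℝ) (tensorCube (coeffSpace φ)) (groupTensor G)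

end Tensor

end BscTensor

/-!
Let `R` be the coefficient space of `φ` and `p` the orthogonal projection of `ℝ^G` onto `R`. The
projection of `δ_G` onto `R ⊗ R ⊗ R` is `∑ 1_a ⊗ 1_b ⊗ p 1_{ab}`: the difference from `δ_G` has
third factors orthogonal to `R`, and the sum lies in `R ⊗ R ⊗ R` for the following reason. Suppose
that `R` consists of the functions `g ↦ f (ψ g)`, where `ψ` maps `G` to a real vector space `A` and
`f` runs through the dual of `A`. Then `p 1_g = h (ψ g)` for a linear map `h` from `A` to `R`. If
moreover `A` carries a product with `ψ (ab) = ψ a * ψ b`, a formula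
`x * y = ∑ f i x * g i y • w i` with `N` terms turns the sum above into
`∑ (f i ∘ ψ) ⊗ (g i ∘ ψ) ⊗ h (w i)`, so that its rank is at most `N`
(`tensorRank_projGroupTensor_le`). No orthogonality relations are needed.

It remains to find `A` for each type. A real `φ` takes values in real `d × d` matrices, with
`N = m_d`. For `φ ≅ ψ ⊕ ψ̄` the coefficients are those of `ψ`, so `A` can be the complex
`d/2 × d/2` matrices, and Gauss's three-term formula gives `N = 3 m_{d/2}`. A quaternionic
irreducible `φ` commutes with an antilinear map `v ↦ P v̄`, whose square can be scaled to `1` or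
`-1` by Schur's lemma. Square `1` would make `φ` real; square `-1` forces `d` to be even and puts `φ`
in the block form `[[A, -C̄], [C, Ā]]`, that of a quaternionic `d/2 × d/2` matrix. Both normal
forms come from `exists_twisted_conj`, a version of Hilbert's Theorem 90. Quaternions multiply with
eight real multiplications (`bilinearRankLE_quatMul`), whence `N = 8 m_{d/2}`.
-/

namespace BscTensor

/-! ### Bilinear rank of a product -/

section BilinearRank

variable {A B : Type*} [AddCommGroup A] [Module ℝ A] [AddCommGroup B] [Module ℝ B]

/-- The product `μ` on the real vector space `A` can be computed with `N` bilinear real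
multiplications: `μ x y = ∑ i, f i x * g i y • w i` with linear functionals `f i`, `g i`. -/
def BilinearRankLE (μ : A → A → A) (N : ℕ) : Prop :=
  ∃ (f g : Fin N → Module.Dual ℝ A) (w : Fin N → A),
    ∀ x y, μ x y = ∑ i, (f i x * g i y) • w i

/-- A product on `B` that is assembled linearly from `T` products in `A` costs at most `T` times as
many real multiplications as the product of `A`. -/
theorem BilinearRankLE.of_sum {μ : A → A → A} {N : ℕ} (hμ : BilinearRankLE μ N) {ν : B → B → B}
    {T : ℕ} (α β : Fin T → B →ₗ[ℝ] A) (γ : Fin T → A →ₗ[ℝ] B)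
    (h : ∀ x y, ν x y = ∑ t, γ t (μ (α t x) (β t y))) : BilinearRankLE ν (T * N) := by
  obtain ⟨f, g, w, hfg⟩ := hμ
  refine ⟨fun i => f (finProdFinEquiv.symm i).2 ∘ₗ α (finProdFinEquiv.symm i).1,
    fun i => g (finProdFinEquiv.symm i).2 ∘ₗ β (finProdFinEquiv.symm i).1,
    fun i => γ (finProdFinEquiv.symm i).1 (w (finProdFinEquiv.symm i).2), fun x y => ?_⟩
  rw [h, ← finProdFinEquiv.sum_comp, Fintype.sum_prod_type]
  simp [hfg]

/-- The tensor rank of matrix multiplication bounds the number of bilinear multiplications. -/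
theorem bilinearRankLE_matMul (d : ℕ) :
    BilinearRankLE (fun X Y : Matrix (Fin d) (Fin d) ℝ => X * Y) (matMulRank d) := by
  obtain ⟨f, g, w, h⟩ := isSumOfPure_tensorRank (matMulTensor d)
  refine ⟨f, g, w, fun X Y => ?_⟩
  -- Contract the first two tensor factors with `X` and `Y`.
  have h' := congrArg ((TensorProduct.lid ℝ (Matrix (Fin d) (Fin d) ℝ)).toLinearMap ∘ₗ
    TensorProduct.map (Module.Dual.eval ℝ _ X)
      ((TensorProduct.lid ℝ (Matrix (Fin d) (Fin d) ℝ)).toLinearMap ∘ₗ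
        TensorProduct.map (Module.Dual.eval ℝ _ Y) LinearMap.id)) h
  simp only [matMulTensor, map_sum, LinearMap.comp_apply, TensorProduct.map_tmul,
    LinearEquiv.coe_coe, TensorProduct.lid_tmul, LinearMap.id_apply, Module.Dual.eval_apply,
    Matrix.entryLinearMap_apply, smul_smul] at h'
  have h'' : X * Y = ∑ i, ∑ j, ∑ k, (X i j * Y j k) • Matrix.single i k (1 : ℝ) := by
    ext a b
    simp [Matrix.mul_apply, Matrix.sum_apply, Matrix.single_apply, ite_and]
  exact h''.trans h'

end BilinearRank

/-! ### The projected tensor and realizations of its coefficient space -/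

section Projection

variable {G A : Type*} [AddCommGroup A] [Module ℝ A]

/-- The functions `g ↦ f (ψ g)` on `G` obtained from the linear functionals `f` on the target of
`ψ : G → A`. -/
def coeffMap (ψ : G → A) : Module.Dual ℝ A →ₗ[ℝ] EuclideanSpace ℝ G where
  toFun f := WithLp.toLp 2 fun g => f (ψ g)
  map_add' _ _ := rfl
  map_smul' _ _ := rfl

theorem coeffMap_apply (ψ : G → A) (f : Module.Dual ℝ A) (g : G) :
    coeffMap ψ f g = f (ψ g) := rfl

theorem coeffMap_eq_sum [Fintype G] [DecidableEq G] (ψ : G → A) (f : Module.Dual ℝ A) :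
    coeffMap ψ f = ∑ a, f (ψ a) • EuclideanSpace.single a (1 : ℝ) := by
  ext g
  simp [coeffMap_apply, Pi.single_apply]

/-- Orthogonal projection onto the space of coefficients of `ψ` factors through the linear
extension of `ψ` to `ℝ^G`. -/
theorem exists_linearMap_eq_starProjection [Fintype G] [DecidableEq G] (ψ : G → A) :
    ∃ h : A →ₗ[ℝ] EuclideanSpace ℝ G, (∀ x, h x ∈ LinearMap.range (coeffMap ψ)) ∧
      ∀ g, h (ψ g) =
        (LinearMap.range (coeffMap ψ)).starProjection (EuclideanSpace.single g (1 : ℝ)) := by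
  -- In an orthonormal basis `e i = (g ↦ f i (ψ g))`, the projection of `1_g` is `∑ f i (ψ g) e i`.
  let e := stdOrthonormalBasis ℝ (LinearMap.range (coeffMap ψ))
  choose f hf using fun i => (e i).2
  refine ⟨∑ i, (f i).smulRight (e i : EuclideanSpace ℝ G), fun x => ?_, fun g => ?_⟩
  · rw [LinearMap.sum_apply]
    exact Submodule.sum_mem _ fun i _ => Submodule.smul_mem _ _ (e i).2
  · rw [Submodule.starProjection_apply, e.orthogonalProjectionOnto_apply_eq_sum]
    simp [← coeffMap_apply, hf, -PiLp.smul_apply, EuclideanSpace.inner_single_right]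

theorem inner_eq_zero_of_mem_span {H : Type*} [NormedAddCommGroup H] [InnerProductSpace ℝ H]
    {D T : H} {S : Set H} (hT : T ∈ Submodule.span ℝ S) (hD : ∀ x ∈ S, inner ℝ D x = 0) :
    inner ℝ D T = 0 := by
  induction hT using Submodule.span_induction with
  | zero => exact inner_zero_right _
  | add x y _ _ hx hy => rw [inner_add_right, hx, hy, add_zero]
  | smul c x _ hx => rw [inner_smul_right, hx, mul_zero]
  | mem x hx => exact hD x hx

theorem inner_sum_tmul {E F ι : Type*} [NormedAddCommGroup E] [InnerProductSpace ℝ E]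
    [NormedAddCommGroup F] [InnerProductSpace ℝ F] [Fintype ι] (x : ι → E) (y : ι → F) (u : E)
    (v : F) : inner ℝ (∑ i, x i ⊗ₜ[ℝ] y i) (u ⊗ₜ[ℝ] v) = ∑ i, inner ℝ (x i) u * inner ℝ (y i) v := by
  simp [sum_inner]

/-- Tensors with third factors orthogonal to `R` are orthogonal to `R ⊗ R ⊗ R`. -/
theorem inner_sum_tmul_eq_zero {E ι : Type*} [NormedAddCommGroup E] [InnerProductSpace ℝ E]
    [Fintype ι] (R : Submodule ℝ E) (x y z : ι → E) (hz : ∀ i, ∀ w ∈ R, inner ℝ (z i) w = 0)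
    {T : E ⊗[ℝ] (E ⊗[ℝ] E)}
    (hT : T ∈ Submodule.span ℝ {T | ∃ u ∈ R, ∃ v ∈ R, ∃ w ∈ R, T = u ⊗ₜ[ℝ] (v ⊗ₜ[ℝ] w)}) :
    inner ℝ (∑ i, x i ⊗ₜ[ℝ] (y i ⊗ₜ[ℝ] z i)) T = 0 := by
  refine inner_eq_zero_of_mem_span (H := E ⊗[ℝ] (E ⊗[ℝ] E)) hT ?_
  rintro _ ⟨u, _, v, _, w, hw, rfl⟩
  refine (inner_sum_tmul x (fun i => y i ⊗ₜ[ℝ] z i) u (v ⊗ₜ[ℝ] w)).trans ?_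
  simp [hz _ w hw]

/-- If the coefficient space of `φ` is realized by a map `ψ` to a space with a product `μ` for
which `ψ` is multiplicative, then the rank of the projected tensor is at most that of `μ`. -/
theorem tensorRank_projGroupTensor_le [Group G] [Fintype G] [DecidableEq G] {n : Type*}
    [Fintype n] [DecidableEq n] (φ : MatRep G n) (ψ : G → A)
    (hR : coeffSpace φ = LinearMap.range (coeffMap ψ)) {μ : A → A → A}
    (hψ : ∀ a b, ψ (a * b) = μ (ψ a) (ψ b)) {N : ℕ} (hμ : BilinearRankLE μ N) :
    tensorRank (projGroupTensor φ) ≤ N := by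
  obtain ⟨f, g, w, hfg⟩ := hμ
  obtain ⟨h, hh, hψh⟩ := exists_linearMap_eq_starProjection ψ
  have key : ∑ i, coeffMap ψ (f i) ⊗ₜ[ℝ] (coeffMap ψ (g i) ⊗ₜ[ℝ] h (w i)) =
      ∑ a : G, ∑ b : G, EuclideanSpace.single a (1 : ℝ) ⊗ₜ[ℝ]
        (EuclideanSpace.single b (1 : ℝ) ⊗ₜ[ℝ] h (ψ (a * b))) := by
    simp only [hψ, hfg, map_sum, map_smul, TensorProduct.tmul_sum]
    rw [Finset.sum_congr rfl fun a _ => Finset.sum_comm, Finset.sum_comm]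
    refine Finset.sum_congr rfl fun i _ => ?_
    rw [coeffMap_eq_sum, coeffMap_eq_sum, TensorProduct.sum_tmul]
    refine Finset.sum_congr rfl fun a _ => ?_
    rw [TensorProduct.sum_tmul, TensorProduct.tmul_sum]
    refine Finset.sum_congr rfl fun b _ => ?_
    rw [← TensorProduct.smul_tmul', ← TensorProduct.smul_tmul', TensorProduct.tmul_smul,
      TensorProduct.tmul_smul, TensorProduct.tmul_smul, smul_smul]
  refine Nat.sInf_le ⟨fun i => coeffMap ψ (f i), fun i => coeffMap ψ (g i), fun i => h (w i), ?_⟩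
  refine Submodule.eq_starProjection_of_mem_of_inner_eq_zero ?_ fun T hT => ?_
  · refine Submodule.sum_mem _ fun i _ => Submodule.subset_span ⟨_, ?_, _, ?_, _, ?_, rfl⟩
    · exact hR ▸ ⟨_, rfl⟩
    · exact hR ▸ ⟨_, rfl⟩
    · exact hR ▸ hh _
  · -- The difference is `∑ 1_a ⊗ 1_b ⊗ (1 - p) 1_{ab}`, whose third factors are orthogonal to `R`.
    rw [key, groupTensor, ← Finset.sum_sub_distrib]
    simp only [← Finset.sum_sub_distrib, ← TensorProduct.tmul_sub]
    rw [← Fintype.sum_prod_type']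
    refine inner_sum_tmul_eq_zero _ _ _ _ (fun p z hz => ?_) hT
    rw [hψh]
    exact Submodule.starProjection_inner_eq_zero _ z (hR ▸ hz)

end Projection

/-! ### Functions whose real and imaginary parts lie in a given space -/

section Coefficients

variable {G : Type*} {R : Submodule ℝ (EuclideanSpace ℝ G)}

/-- The complex-valued functions on `G` with real and imaginary part in `R`. -/
def complexified (R : Submodule ℝ (EuclideanSpace ℝ G)) : Submodule ℂ (G → ℂ) where
  carrier := {u | WithLp.toLp 2 (fun g => (u g).re) ∈ R ∧ WithLp.toLp 2 (fun g => (u g).im) ∈ R}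
  zero_mem' := ⟨R.zero_mem, R.zero_mem⟩
  add_mem' hu hv := ⟨R.add_mem hu.1 hv.1, R.add_mem hu.2 hv.2⟩
  smul_mem' c u hu := by
    constructor
    · convert! R.sub_mem (R.smul_mem c.re hu.1) (R.smul_mem c.im hu.2) using 1
    · convert! R.add_mem (R.smul_mem c.re hu.2) (R.smul_mem c.im hu.1) using 1

theorem conj_mem_complexified {u : G → ℂ} (hu : u ∈ complexified R) :
    (fun g => starRingEnd ℂ (u g)) ∈ complexified R :=
  ⟨hu.1, R.neg_mem hu.2⟩

theorem mem_complexified_range_coeffMap {A : Type*} [AddCommGroup A] [Module ℝ A]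
    (ψ : G → A)
    (ℓ : A →ₗ[ℝ] ℂ) :
    (fun g => ℓ (ψ g)) ∈ complexified (LinearMap.range (coeffMap ψ)) :=
  ⟨⟨Complex.reLm ∘ₗ ℓ, rfl⟩, ⟨Complex.imLm ∘ₗ ℓ, rfl⟩⟩

variable {m n : Type*} [Fintype m] [DecidableEq m] [Fintype n] [DecidableEq n]

/-- All real linear coefficients of a complex matrix-valued function lie in a space that contains
the real and imaginary parts of its entries. -/
theorem coeffMap_mem (F : G → Matrix m n ℂ) (hF : ∀ i j, (fun g => F g i j) ∈ complexified R)
    (f : Module.Dual ℝ (Matrix m n ℂ)) : coeffMap F f ∈ R := by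
  have : coeffMap F f = ∑ i, ∑ j,
      (f (Matrix.single i j 1) • WithLp.toLp 2 (fun g => (F g i j).re) +
        f (Matrix.single i j Complex.I) • WithLp.toLp 2 (fun g => (F g i j).im)) := by
    ext g
    have hg : F g = ∑ i, ∑ j, ((F g i j).re • Matrix.single i j (1 : ℂ) +
        (F g i j).im • Matrix.single i j Complex.I) := by
      conv_lhs => rw [Matrix.matrix_eq_sum_single (F g)]
      refine Finset.sum_congr rfl fun i _ => Finset.sum_congr rfl fun j _ => ?_
      rw [Matrix.smul_single, Matrix.smul_single, ← Matrix.single_add]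
      congr 1
      apply Complex.ext <;> simp
    rw [coeffMap_apply, hg]
    simp only [map_sum, map_add, map_smul]
    simp [-Matrix.smul_single, mul_comm]
  rw [this]
  exact Submodule.sum_mem _ fun i _ => Submodule.sum_mem _ fun j _ =>
    R.add_mem (R.smul_mem _ (hF i j).1) (R.smul_mem _ (hF i j).2)

variable [Group G]

theorem coeffSpace_le_iff {φ : MatRep G n} :
    coeffSpace φ ≤ R ↔ ∀ i j, (fun g => (φ g : Matrix n n ℂ) i j) ∈ complexified R := by
  rw [coeffSpace, Submodule.span_le, Set.union_subset_iff]
  constructor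
  · exact fun h i j => ⟨h.1 ⟨i, j, rfl⟩, h.2 ⟨i, j, rfl⟩⟩
  · rintro h
    constructor
    · rintro _ ⟨i, j, rfl⟩
      exact (h i j).1
    · rintro _ ⟨i, j, rfl⟩
      exact (h i j).2

theorem Isomorphic.symm {φ : MatRep G m} {ψ : MatRep G n} (h : Isomorphic φ ψ) :
    Isomorphic ψ φ := by
  obtain ⟨P, Q, hPQ, hQP, h⟩ := h
  refine ⟨Q, P, hQP, hPQ, fun g => ?_⟩
  rw [h, Matrix.mul_assoc, Matrix.mul_assoc, hQP, Matrix.mul_one, ← Matrix.mul_assoc, hQP,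
    Matrix.one_mul]

theorem Isomorphic.coeffSpace_le {φ : MatRep G m} {ψ : MatRep G n} (h : Isomorphic φ ψ) :
    coeffSpace φ ≤ coeffSpace ψ := by
  obtain ⟨P, Q, -, -, h⟩ := h
  rw [coeffSpace_le_iff]
  intro i j
  have : (fun g => (φ g : Matrix m m ℂ) i j) =
      ∑ l, ∑ k, (P i k * Q l j) • fun g => (ψ g : Matrix n n ℂ) k l := by
    ext g
    simp only [h, Matrix.mul_apply, Finset.sum_apply, Pi.smul_apply, smul_eq_mul, Finset.sum_mul]
    exact Finset.sum_congr rfl fun _ _ => Finset.sum_congr rfl fun _ _ => by ring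
  rw [this]
  exact Submodule.sum_mem _ fun l _ => Submodule.sum_mem _ fun k _ =>
    Submodule.smul_mem _ _ (coeffSpace_le_iff.1 le_rfl k l)

theorem Isomorphic.coeffSpace_eq {φ : MatRep G m} {ψ : MatRep G n} (h : Isomorphic φ ψ) :
    coeffSpace φ = coeffSpace ψ :=
  le_antisymm h.coeffSpace_le h.symm.coeffSpace_le

end Coefficients

/-! ### Complex and quaternionic matrix multiplication -/

section Products

variable {k : ℕ}

/-- The real part of a complex matrix. -/
noncomputable def matRe (k : ℕ) : Matrix (Fin k) (Fin k) ℂ →ₗ[ℝ] Matrix (Fin k) (Fin k) ℝ :=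
  Complex.reLm.mapMatrix

/-- The imaginary part of a complex matrix. -/
noncomputable def matIm (k : ℕ) : Matrix (Fin k) (Fin k) ℂ →ₗ[ℝ] Matrix (Fin k) (Fin k) ℝ :=
  Complex.imLm.mapMatrix

/-- A real matrix, regarded as a complex one. -/
noncomputable def matOfReal (k : ℕ) : Matrix (Fin k) (Fin k) ℝ →ₗ[ℝ] Matrix (Fin k) (Fin k) ℂ :=
  Complex.ofRealAm.toLinearMap.mapMatrix

theorem matOfReal_mul (X Y : Matrix (Fin k) (Fin k) ℝ) :
    matOfReal k (X * Y) = matOfReal k X * matOfReal k Y := by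
  change (X * Y).map Complex.ofRealHom = X.map Complex.ofRealHom * Y.map Complex.ofRealHom
  exact Matrix.map_mul

theorem matOfReal_re_add_im (X : Matrix (Fin k) (Fin k) ℂ) :
    X = matOfReal k (matRe k X) + Complex.I • matOfReal k (matIm k X) := by
  ext i j
  simp [matOfReal, matRe, matIm, mul_comm Complex.I]

theorem map_conj_eq_matOfReal_re_sub_im (X : Matrix (Fin k) (Fin k) ℂ) :
    X.map (starRingEnd ℂ) = matOfReal k (matRe k X) - Complex.I • matOfReal k (matIm k X) := by
  ext i j
  apply Complex.ext <;> simp [matOfReal, matRe, matIm]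

/-- Gauss's trick: a product of complex matrices takes three products of real matrices. -/
theorem bilinearRankLE_complex_matMul (k : ℕ) :
    BilinearRankLE (fun X Y : Matrix (Fin k) (Fin k) ℂ => X * Y) (3 * matMulRank k) := by
  refine (bilinearRankLE_matMul k).of_sum ![matRe k, matIm k, matRe k + matIm k]
    ![matRe k, matIm k, matRe k + matIm k]
    ![(1 - Complex.I) • matOfReal k, (-1 - Complex.I) • matOfReal k, Complex.I • matOfReal k]
    fun X Y => ?_
  conv_lhs => rw [matOfReal_re_add_im X, matOfReal_re_add_im Y]
  simp only [Fin.sum_univ_three, Matrix.cons_val, LinearMap.smul_apply, LinearMap.add_apply,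
    matOfReal_mul, map_add, mul_add, add_mul, Matrix.smul_mul, Matrix.mul_smul]
  simp only [smul_smul, Complex.I_mul_I]
  module

/-- The product of two quaternionic matrices in complex coordinates: `(A, C)` stands for the complex
block matrix `[[A, -C̄], [C, Ā]]`, which is determined by its first block column. -/
noncomputable def quatMul (x y : Matrix (Fin k) (Fin k) ℂ × Matrix (Fin k) (Fin k) ℂ) :
    Matrix (Fin k) (Fin k) ℂ × Matrix (Fin k) (Fin k) ℂ :=
  (x.1 * y.1 - x.2.map (starRingEnd ℂ) * y.2, x.2 * y.1 + x.1.map (starRingEnd ℂ) * y.2)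

/-- A product of quaternionic matrices takes eight products of real matrices. -/
theorem bilinearRankLE_quatMul (k : ℕ) :
    BilinearRankLE (quatMul (k := k)) (8 * matMulRank k) := by
  let a₀ := matRe k ∘ₗ LinearMap.fst ℝ _ (Matrix (Fin k) (Fin k) ℂ)
  let a₁ := matIm k ∘ₗ LinearMap.fst ℝ _ (Matrix (Fin k) (Fin k) ℂ)
  let a₂ := matRe k ∘ₗ LinearMap.snd ℝ (Matrix (Fin k) (Fin k) ℂ) _
  let a₃ := matIm k ∘ₗ LinearMap.snd ℝ (Matrix (Fin k) (Fin k) ℂ) _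
  let γ (c c' : ℂ) := (c • matOfReal k).prod (c' • matOfReal k)
  have hγ : ∀ c c' Z, γ c c' Z = (c • matOfReal k Z, c' • matOfReal k Z) := fun _ _ _ => rfl
  -- Up to signs the quaternion product is the product of the group algebra of `(ℤ/2)²`, which the
  -- four characters diagonalize. The wrong signs occur in four terms `xᵢ yⱼ`, one for each
  -- coordinate of the product, and those are corrected separately.
  refine (bilinearRankLE_matMul k).of_sum
    ![a₀ + a₁ + a₂ + a₃, a₀ + a₁ - a₂ - a₃, a₀ - a₁ + a₂ - a₃, a₀ - a₁ - a₂ + a₃, a₀, a₂, a₃, a₁]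
    ![a₀ + a₁ + a₂ + a₃, a₀ + a₁ - a₂ - a₃, a₀ - a₁ + a₂ - a₃, a₀ - a₁ - a₂ + a₃, a₀, a₃, a₁, a₂]
    ![γ ((-1 + Complex.I) / 4) ((1 + Complex.I) / 4),
      γ ((-1 + Complex.I) / 4) ((-1 - Complex.I) / 4),
      γ ((-1 - Complex.I) / 4) ((1 - Complex.I) / 4),
      γ ((-1 - Complex.I) / 4) ((-1 + Complex.I) / 4),
      γ 2 0, γ (-2 * Complex.I) 0, γ 0 (-2), γ 0 (-2 * Complex.I)]
    fun x y => ?_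
  obtain ⟨A, C⟩ := x
  obtain ⟨A', C'⟩ := y
  have hA := matOfReal_re_add_im A
  have hC := matOfReal_re_add_im C
  have hA' := matOfReal_re_add_im A'
  have hC' := matOfReal_re_add_im C'
  have hAc := map_conj_eq_matOfReal_re_sub_im A
  have hCc := map_conj_eq_matOfReal_re_sub_im C
  simp only [Fin.sum_univ_eight, Matrix.cons_val, hγ, LinearMap.add_apply, LinearMap.sub_apply,
    LinearMap.comp_apply, LinearMap.fst_apply, LinearMap.snd_apply, a₀, a₁, a₂, a₃, matOfReal_mul,
    map_add, map_sub, quatMul, hAc, hCc]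
  generalize matOfReal k (matRe k A) = A₀, matOfReal k (matIm k A) = A₁,
    matOfReal k (matRe k C) = A₂, matOfReal k (matIm k C) = A₃,
    matOfReal k (matRe k A') = B₀, matOfReal k (matIm k A') = B₁,
    matOfReal k (matRe k C') = B₂, matOfReal k (matIm k C') = B₃ at hA hC hA' hC' ⊢
  subst hA hC hA' hC'
  ext1 <;>
  · simp only [Prod.fst_add, Prod.snd_add, mul_add, add_mul, mul_sub, sub_mul, Matrix.smul_mul,
      Matrix.mul_smul]
    simp only [smul_smul, Complex.I_mul_I]
    module

end Products

/-! ### Real and complex representations -/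

section TypeOneTwo

variable {G : Type*} [Group G] {n : Type*} [Fintype n] [DecidableEq n]

theorem conjRep_apply (φ : MatRep G n) (g : G) :
    (conjRep φ g : Matrix n n ℂ) = (φ g : Matrix n n ℂ).map (starRingEnd ℂ) := rfl

theorem Isomorphic.card_eq {m : Type*} [Fintype m] [DecidableEq m] {φ : MatRep G m}
    {ψ : MatRep G n} (h : Isomorphic φ ψ) : Fintype.card m = Fintype.card n := by
  obtain ⟨P, Q, hPQ, hQP, -⟩ := h
  exact Matrix.square_of_invertible P Q hPQ hQP

variable [Fintype G] [DecidableEq G]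

theorem tensorRank_projGroupTensor_congr {m : Type*} [Fintype m] [DecidableEq m]
    {φ : MatRep G m} {ψ : MatRep G n} (h : Isomorphic φ ψ) :
    tensorRank (projGroupTensor φ) = tensorRank (projGroupTensor ψ) := by
  simp only [projGroupTensor, h.coeffSpace_eq]

theorem tensorRank_projGroupTensor_le_of_isReal {d : ℕ} {φ : MatRep G (Fin d)} (h : IsReal φ) :
    tensorRank (projGroupTensor φ) ≤ matMulRank d := by
  obtain ⟨ψ, hφψ, hψ⟩ := h
  have hre : ∀ g, (ψ g : Matrix (Fin d) (Fin d) ℂ) = matOfReal d (matRe d (ψ g)) := fun g => by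
    ext i j
    exact Complex.ext rfl (hψ g i j)
  rw [tensorRank_projGroupTensor_congr hφψ]
  refine tensorRank_projGroupTensor_le ψ (fun g => matRe d (ψ g)) (le_antisymm ?_ ?_)
    (fun a b => ?_) (bilinearRankLE_matMul d)
  · rw [coeffSpace_le_iff]
    intro i j
    rw [funext fun g => congrFun (congrFun (hre g) i) j]
    exact mem_complexified_range_coeffMap (fun g => matRe d (ψ g))
      (Complex.ofRealAm.toLinearMap ∘ₗ Matrix.entryLinearMap ℝ ℝ i j)
  · rintro _ ⟨f, rfl⟩
    exact coeffMap_mem (fun g => (ψ g : Matrix (Fin d) (Fin d) ℂ))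
      (coeffSpace_le_iff.1 le_rfl) (f ∘ₗ matRe d)
  · have : Function.Injective (matOfReal d) := fun X Y h => by
      ext i j
      exact Complex.ofReal_injective (congrFun (congrFun h i) j)
    apply this
    rw [matOfReal_mul, ← hre, ← hre, ← hre, map_mul, Units.val_mul]

theorem tensorRank_projGroupTensor_directSum_conjRep_le {k : ℕ} (ψ : MatRep G (Fin k)) :
    tensorRank (projGroupTensor (directSum ψ (conjRep ψ))) ≤ 3 * matMulRank k := by
  refine tensorRank_projGroupTensor_le _ (fun g => (ψ g : Matrix (Fin k) (Fin k) ℂ))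
    (le_antisymm ?_ ?_) (fun a b => ?_) (bilinearRankLE_complex_matMul k)
  · have h : ∀ i j, (fun g => (ψ g : Matrix (Fin k) (Fin k) ℂ) i j) ∈
        complexified (LinearMap.range (coeffMap fun g => (ψ g : Matrix (Fin k) (Fin k) ℂ))) :=
      fun i j => mem_complexified_range_coeffMap _ (Matrix.entryLinearMap ℝ ℂ i j)
    rw [coeffSpace_le_iff]
    rintro (i | i) (j | j)
    · exact h i j
    · exact Submodule.zero_mem _
    · exact Submodule.zero_mem _
    · exact conj_mem_complexified (h i j)
  · rintro _ ⟨f, rfl⟩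
    exact coeffMap_mem _
      (fun i j => coeffSpace_le_iff.1 (le_refl (coeffSpace (directSum ψ (conjRep ψ))))
        (Sum.inl i) (Sum.inl j)) f
  · rw [map_mul, Units.val_mul]

end TypeOneTwo

/-! ### Real and quaternionic structures -/

section Structures

theorem map_conj_mul {m n l : Type*} [Fintype n] (M : Matrix m n ℂ) (N : Matrix n l ℂ) :
    (M * N).map (starRingEnd ℂ) = M.map (starRingEnd ℂ) * N.map (starRingEnd ℂ) :=
  Matrix.map_mul

theorem map_conj_map_conj {m n : Type*} (M : Matrix m n ℂ) :
    (M.map (starRingEnd ℂ)).map (starRingEnd ℂ) = M := by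
  ext; simp

theorem map_conj_smul_one {n : Type*} [DecidableEq n] (c : ℂ) :
    (c • (1 : Matrix n n ℂ)).map (starRingEnd ℂ) = starRingEnd ℂ c • 1 := by
  ext i j
  by_cases h : i = j <;> simp [h]

variable {G : Type*} [Group G] {n : Type*} [Fintype n] [DecidableEq n]

/-- Schur's lemma for matrix representations. -/
theorem IsIrred.exists_eq_smul_one {φ : MatRep G n} (hφ : IsIrred φ) (M : Matrix n n ℂ)
    (hM : ∀ g, (φ g : Matrix n n ℂ) * M = M * (φ g : Matrix n n ℂ)) : ∃ c : ℂ, M = c • 1 := by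
  have : (toRep φ).IsIrreducible := hφ
  let f : Representation.IntertwiningMap (toRep φ) (toRep φ) :=
    ⟨Matrix.toLin' M, fun g => by
      change Matrix.toLin' M ∘ₗ Matrix.toLin' (φ g : Matrix n n ℂ) =
        Matrix.toLin' (φ g : Matrix n n ℂ) ∘ₗ Matrix.toLin' M
      rw [← Matrix.toLin'_mul, ← Matrix.toLin'_mul, hM]⟩
  obtain ⟨c, hc⟩ :=
    (Representation.IsIrreducible.algebraMap_intertwiningMap_bijective_of_isAlgClosed
      (k := ℂ) (ρ := toRep φ)).2 f
  refine ⟨c, Matrix.toLin'.injective (LinearMap.ext fun v => ?_)⟩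
  have := congrArg (fun F : Representation.IntertwiningMap (toRep φ) (toRep φ) => F v) hc
  rw [map_smul, Matrix.toLin'_one]
  exact this.symm

/-- An irreducible self-conjugate representation commutes with an antilinear map `v ↦ P v̄` of
square `1` or `-1`: by Schur's lemma the square `P P̄` of any invertible such map is a scalar, which
equals its own conjugate `P̄ P` and so is real. -/
theorem IsIrred.exists_structure {φ : MatRep G n} (hφ : IsIrred φ) (hn : 0 < Fintype.card n)
    (hc : IsSelfConj φ) : ∃ P : Matrix n n ℂ,
      (∀ g, (φ g : Matrix n n ℂ) * P = P * (φ g : Matrix n n ℂ).map (starRingEnd ℂ)) ∧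
      (P * P.map (starRingEnd ℂ) = 1 ∨ P * P.map (starRingEnd ℂ) = -1) := by
  obtain ⟨P, Q, hPQ, hQP, h⟩ := hc
  simp only [conjRep_apply] at h
  have : Nonempty n := Fintype.card_pos_iff.1 hn
  have hcomm : ∀ g, (φ g : Matrix n n ℂ) * P = P * (φ g : Matrix n n ℂ).map (starRingEnd ℂ) :=
    fun g => by
      conv_lhs => rw [h g, mul_assoc, hQP, mul_one]
  have hcomm' : ∀ g, (φ g : Matrix n n ℂ).map (starRingEnd ℂ) * P.map (starRingEnd ℂ) =
      P.map (starRingEnd ℂ) * (φ g : Matrix n n ℂ) := fun g => by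
    rw [← map_conj_mul, hcomm, map_conj_mul, map_conj_map_conj]
  obtain ⟨c, hcP⟩ := hφ.exists_eq_smul_one (P * P.map (starRingEnd ℂ)) fun g => by
    rw [← mul_assoc, hcomm, mul_assoc, hcomm', mul_assoc]
  have hPc : P.map (starRingEnd ℂ) * P = c • 1 := by
    rw [← one_mul (P.map _ * P), ← hQP, mul_assoc, ← mul_assoc P, hcP, smul_mul_assoc, one_mul,
      mul_smul_comm]
  have hreal : starRingEnd ℂ c = c := by
    have h1 := congrArg (fun M : Matrix n n ℂ => M.map (starRingEnd ℂ)) hcP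
    simp only [map_conj_mul, map_conj_map_conj, map_conj_smul_one, hPc] at h1
    obtain ⟨i⟩ := this
    simpa using (congrFun (congrFun h1 i) i).symm
  obtain ⟨r, rfl⟩ := Complex.conj_eq_iff_real.1 hreal
  have hr : r ≠ 0 := by
    rintro rfl
    have h1 : P = 0 := by
      have : P.map (starRingEnd ℂ) * P * Q = 0 := by rw [hPc]; simp
      rw [mul_assoc, hPQ, mul_one] at this
      rw [← map_conj_map_conj P, this]
      ext; simp
    rw [h1, zero_mul] at hPQ
    exact zero_ne_one hPQ
  -- Rescale `P` by the positive real number `|r|^{-1/2}`.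
  have hs : ((Real.sqrt |r|)⁻¹ * (Real.sqrt |r|)⁻¹) * |r| = 1 := by
    have : Real.sqrt |r| ≠ 0 := (Real.sqrt_pos.2 (abs_pos.2 hr)).ne'
    rw [← mul_inv, Real.mul_self_sqrt (abs_nonneg r)]
    exact inv_mul_cancel₀ (abs_ne_zero.2 hr)
  generalize (Real.sqrt |r|)⁻¹ = s at hs
  have hsP : ((s : ℂ) • P) * ((s : ℂ) • P).map (starRingEnd ℂ) = (s * s * r : ℝ) • 1 := by
    have : ((s : ℂ) • P).map (starRingEnd ℂ) = (s : ℂ) • P.map (starRingEnd ℂ) := by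
      ext; simp
    rw [this, smul_mul_assoc, mul_smul_comm, hcP, smul_smul, smul_smul]
    ext i j
    simp
  refine ⟨(s : ℂ) • P, fun g => by rw [mul_smul_comm, hcomm, smul_mul_assoc], ?_⟩
  rw [hsP]
  rcases abs_cases r with ⟨h, -⟩ | ⟨h, -⟩
  · left
    rw [h] at hs
    rw [hs, one_smul]
  · right
    rw [h, mul_neg, neg_eq_iff_eq_neg] at hs
    rw [hs, neg_smul, one_smul]

/-- Two invertible matrices `P`, `Ω` with `P P̄ = Ω Ω̄ = ±1` are twisted conjugates. Every matrix
`X + P X̄ Ω⁻¹` intertwines the antilinear maps that they define, and `X` can be taken scalar. -/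
theorem exists_twisted_conj {P Ω : Matrix n n ℂ} {c : ℂ} (hc : c * c = 1)
    (hP : P * P.map (starRingEnd ℂ) = c • 1) (hΩ : Ω * Ω.map (starRingEnd ℂ) = c • 1) :
    ∃ T : Matrix n n ℂ, IsUnit T ∧ P * T.map (starRingEnd ℂ) = T * Ω := by
  have hΩ' : Ω.map (starRingEnd ℂ) * Ω = c • 1 := by
    have h1 : Ω * (c • Ω.map (starRingEnd ℂ)) = 1 := by
      rw [mul_smul_comm, hΩ, smul_smul, hc, one_smul]
    have h2 := mul_eq_one_comm.1 h1
    rw [smul_mul_assoc] at h2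
    rw [← h2, smul_smul, hc, one_smul]
  have hcc : starRingEnd ℂ c = c := by
    rcases mul_self_eq_one_iff.1 hc with rfl | rfl <;> simp
  obtain ⟨N, hN⟩ : ∃ N : Matrix n n ℂ, N = c • (P * Ω.map (starRingEnd ℂ)) := ⟨_, rfl⟩
  -- `T = z + z̄ N` with `N = P Ω⁻¹` and `z = t + i` is invertible unless `-z / z̄` is an eigenvalue
  -- of `N`, which happens for finitely many real `t` only.
  have hne : ∀ t : ℝ, (t : ℂ) - Complex.I ≠ 0 := fun t h => by
    simpa using congrArg Complex.im h
  have hinj : Function.Injective fun t : ℝ => -((t : ℂ) + Complex.I) / ((t : ℂ) - Complex.I) := by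
    intro t u h
    simp only [div_eq_div_iff (hne t) (hne u)] at h
    have h2 : (2 * Complex.I) * ((t : ℂ) - u) = 0 := by linear_combination h
    have h3 := (mul_eq_zero.1 h2).resolve_left (by simp)
    exact_mod_cast sub_eq_zero.1 h3
  obtain ⟨_, ⟨t, rfl⟩, ht⟩ :=
    ((Set.infinite_range_of_injective hinj).sdiff (Matrix.finite_spectrum N)).nonempty
  refine ⟨((t : ℂ) + Complex.I) • 1 + ((t : ℂ) - Complex.I) • N, ?_, ?_⟩
  · have h1 := spectrum.notMem_iff.1 ht
    have h2 : ((t : ℂ) + Complex.I) • 1 + ((t : ℂ) - Complex.I) • N =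
        -((t : ℂ) - Complex.I) • (algebraMap ℂ (Matrix n n ℂ)
          (-((t : ℂ) + Complex.I) / ((t : ℂ) - Complex.I)) - N) := by
      have h3 : -((t : ℂ) - Complex.I) * (-((t : ℂ) + Complex.I) / ((t : ℂ) - Complex.I)) =
          (t : ℂ) + Complex.I := by
        field_simp [hne t]
      rw [Algebra.algebraMap_eq_smul_one, smul_sub, smul_smul, h3, neg_smul, sub_neg_eq_add]
    rw [h2]
    exact (IsUnit.smul (Units.mk0 _ (neg_ne_zero.2 (hne t))) h1 :)
  · have hNbar : N.map (starRingEnd ℂ) = c • (P.map (starRingEnd ℂ) * Ω) := by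
      rw [hN, Matrix.map_smul' _ _ _ (map_mul _), map_conj_mul, map_conj_map_conj, hcc]
    have h1 : (((t : ℂ) + Complex.I) • 1 + ((t : ℂ) - Complex.I) • N).map (starRingEnd ℂ) =
        ((t : ℂ) - Complex.I) • 1 + ((t : ℂ) + Complex.I) • N.map (starRingEnd ℂ) := by
      rw [Matrix.map_add _ (map_add _), map_conj_smul_one,
        Matrix.map_smul' _ _ _ (map_mul _)]
      simp [sub_eq_add_neg]
    rw [h1, hNbar, hN, mul_add, add_mul, mul_smul_comm, mul_smul_comm, mul_smul_comm,
      ← mul_assoc P, hP, smul_mul_assoc, smul_mul_assoc, smul_mul_assoc, smul_mul_assoc, mul_assoc,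
      hΩ', mul_smul_comm]
    simp only [smul_smul, mul_one, one_mul, hc, one_smul]
    rw [add_comm]

/-- The matrix of `φ` in the basis given by the columns of `P`. -/
def changeBasis {m : Type*} [Fintype m] [DecidableEq m] (φ : MatRep G n) (P : Matrix n m ℂ)
    (Q : Matrix m n ℂ) (hPQ : P * Q = 1) (hQP : Q * P = 1) : MatRep G m :=
  MonoidHom.toHomUnits
    { toFun g := Q * (φ g : Matrix n n ℂ) * P
      map_one' := by simp [hQP]
      map_mul' g h := by
        rw [map_mul, Units.val_mul]
        calc Q * ((φ g : Matrix n n ℂ) * (φ h : Matrix n n ℂ)) * P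
            = Q * (φ g : Matrix n n ℂ) * (1 : Matrix n n ℂ) * (φ h : Matrix n n ℂ) * P := by
              simp only [Matrix.mul_assoc, Matrix.one_mul]
          _ = _ := by rw [← hPQ]; simp only [Matrix.mul_assoc] }

theorem changeBasis_apply {m : Type*} [Fintype m] [DecidableEq m] (φ : MatRep G n)
    (P : Matrix n m ℂ) (Q : Matrix m n ℂ) (hPQ : P * Q = 1) (hQP : Q * P = 1) (g : G) :
    (changeBasis φ P Q hPQ hQP g : Matrix m m ℂ) = Q * (φ g : Matrix n n ℂ) * P := rfl

theorem isomorphic_changeBasis {m : Type*} [Fintype m] [DecidableEq m] (φ : MatRep G n)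
    (P : Matrix n m ℂ) (Q : Matrix m n ℂ) (hPQ : P * Q = 1) (hQP : Q * P = 1) :
    Isomorphic φ (changeBasis φ P Q hPQ hQP) := by
  refine ⟨P, Q, hPQ, hQP, fun g => ?_⟩
  rw [changeBasis_apply]
  calc (φ g : Matrix n n ℂ) = 1 * (φ g : Matrix n n ℂ) * 1 := by simp
    _ = _ := by rw [← hPQ]; simp only [Matrix.mul_assoc]

/-- A representation commuting with `v ↦ P v̄` commutes with `v ↦ Ω v̄` after a change of basis that
takes the first map to the second. -/
theorem changeBasis_comm {m : Type*} [Fintype m] [DecidableEq m] {φ : MatRep G n}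
    {P : Matrix n n ℂ}
    (hP : ∀ g, (φ g : Matrix n n ℂ) * P = P * (φ g : Matrix n n ℂ).map (starRingEnd ℂ))
    {Ω : Matrix m m ℂ} {T : Matrix n m ℂ} {S : Matrix m n ℂ} (hTS : T * S = 1) (hST : S * T = 1)
    (hT : P * T.map (starRingEnd ℂ) = T * Ω) (g : G) :
    (changeBasis φ T S hTS hST g : Matrix m m ℂ) * Ω =
      Ω * (changeBasis φ T S hTS hST g : Matrix m m ℂ).map (starRingEnd ℂ) := by
  have hTS' : T.map (starRingEnd ℂ) * S.map (starRingEnd ℂ) = 1 := by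
    rw [← Matrix.map_mul, hTS]
    simp
  have hΩ : Ω = S * (P * T.map (starRingEnd ℂ)) := by
    rw [hT, ← Matrix.mul_assoc, hST, Matrix.one_mul]
  rw [changeBasis_apply, Matrix.map_mul, Matrix.map_mul, Matrix.mul_assoc _ T, ← hT, hΩ]
  calc S * (φ g : Matrix n n ℂ) * (P * T.map (starRingEnd ℂ))
      = S * ((φ g : Matrix n n ℂ) * P) * T.map (starRingEnd ℂ) := by simp only [Matrix.mul_assoc]
    _ = S * (P * (1 * (φ g : Matrix n n ℂ).map (starRingEnd ℂ))) * T.map (starRingEnd ℂ) := by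
        rw [hP, Matrix.one_mul]
    _ = _ := by rw [← hTS']; simp only [Matrix.mul_assoc]

/-- A representation with an antilinear symmetry of square `1` has a real form. -/
theorem isReal_of_structure {φ : MatRep G n} {P : Matrix n n ℂ}
    (hP : ∀ g, (φ g : Matrix n n ℂ) * P = P * (φ g : Matrix n n ℂ).map (starRingEnd ℂ))
    (hPP : P * P.map (starRingEnd ℂ) = 1) : IsReal φ := by
  obtain ⟨T, ⟨T, rfl⟩, hT⟩ := exists_twisted_conj (P := P) (Ω := 1) (c := 1) (by simp)
    (by simpa using hPP) (by simp)
  refine ⟨_, isomorphic_changeBasis φ (T : Matrix n n ℂ) (T⁻¹ : (Matrix n n ℂ)ˣ) T.mul_inv T.inv_mul,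
    fun g i j => ?_⟩
  have h := changeBasis_comm hP T.mul_inv T.inv_mul hT g
  rw [mul_one, one_mul] at h
  exact Complex.conj_eq_iff_im.1 (congrFun (congrFun h i) j).symm

/-- The determinant of `P P̄` is `|det P|² ≥ 0`, whereas that of `-1` is `-1` in odd size. -/
theorem even_card_of_mul_conj_eq_neg_one {P : Matrix n n ℂ}
    (hPP : P * P.map (starRingEnd ℂ) = -1) : Even (Fintype.card n) := by
  have h := congrArg Matrix.det hPP
  rw [Matrix.det_mul, Matrix.det_neg, Matrix.det_one, mul_one] at h
  have h1 : (P.map (starRingEnd ℂ)).det = starRingEnd ℂ P.det :=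
    ((starRingEnd ℂ).map_det P).symm
  rw [h1, Complex.mul_conj] at h
  by_contra hodd
  rw [(Nat.not_even_iff_odd.1 hodd).neg_one_pow] at h
  have h2 : Complex.normSq P.det = -1 := by exact_mod_cast h
  linarith [Complex.normSq_nonneg P.det]

/-- A representation with a quaternionic structure is isomorphic to one by complex matrices in
quaternionic block form. -/
theorem exists_quaternionic_form {k : ℕ} {φ : MatRep G n} (hn : Fintype.card n = k + k)
    {P : Matrix n n ℂ}
    (hP : ∀ g, (φ g : Matrix n n ℂ) * P = P * (φ g : Matrix n n ℂ).map (starRingEnd ℂ))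
    (hPP : P * P.map (starRingEnd ℂ) = -1) :
    ∃ ψ : MatRep G (Fin k ⊕ Fin k), Isomorphic φ ψ ∧
      ∀ g, ∃ A C : Matrix (Fin k) (Fin k) ℂ, (ψ g : Matrix (Fin k ⊕ Fin k) (Fin k ⊕ Fin k) ℂ) =
        Matrix.fromBlocks A (-C.map (starRingEnd ℂ)) C (A.map (starRingEnd ℂ)) := by
  let e : n ≃ Fin k ⊕ Fin k := Fintype.equivOfCardEq (by simp [hn])
  let J : Matrix (Fin k ⊕ Fin k) (Fin k ⊕ Fin k) ℂ := Matrix.J (Fin k) ℂ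
  have hJ : J.map (starRingEnd ℂ) = J := Matrix.map_J _ _
  have hJJ : J * J = -1 := Matrix.J_squared _ _
  obtain ⟨T, ⟨T, rfl⟩, hT⟩ := exists_twisted_conj (P := P) (Ω := J.submatrix e e) (c := -1)
    (by simp) (by simpa using hPP) (by
      rw [← Matrix.submatrix_map, hJ, Matrix.submatrix_mul_equiv, hJJ, neg_one_smul]
      exact congrArg Neg.neg (Matrix.submatrix_one_equiv e))
  let T' : Matrix n (Fin k ⊕ Fin k) ℂ := (T : Matrix n n ℂ).submatrix id e.symm
  let S' : Matrix (Fin k ⊕ Fin k) n ℂ := ((T⁻¹ : (Matrix n n ℂ)ˣ) : Matrix n n ℂ).submatrix e.symm id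
  have hTS : T' * S' = 1 := by
    rw [Matrix.submatrix_mul_equiv, T.mul_inv, Matrix.submatrix_id_id]
  have hST : S' * T' = 1 := by
    rw [← Matrix.submatrix_mul _ _ _ _ _ Function.bijective_id, T.inv_mul,
      Matrix.submatrix_one_equiv]
  have hT' : P * T'.map (starRingEnd ℂ) = T' * J := by
    ext i j
    have := congrFun (congrFun hT i) (e.symm j)
    rw [Matrix.mul_apply, Matrix.mul_apply, ← e.symm.sum_comp (fun x => (T : Matrix n n ℂ) i x * _)]
      at this
    simpa [T', Matrix.mul_apply] using this
  refine ⟨_, isomorphic_changeBasis φ T' S' hTS hST, fun g => ?_⟩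
  have h := changeBasis_comm hP hTS hST hT' g
  generalize (changeBasis φ T' S' hTS hST g : Matrix (Fin k ⊕ Fin k) (Fin k ⊕ Fin k) ℂ) = M at h
  rw [← Matrix.fromBlocks_toBlocks M] at h ⊢
  simp only [J, Matrix.J, Matrix.fromBlocks_map, Matrix.fromBlocks_multiply] at h
  obtain ⟨h1, h2, h3, h4⟩ := Matrix.fromBlocks_inj.1 h
  simp only [mul_zero, mul_one, zero_mul, one_mul, zero_add, add_zero, mul_neg, neg_mul, neg_inj]
    at h1 h2 h3 h4
  refine ⟨M.toBlocks₁₁, M.toBlocks₂₁, ?_⟩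
  rw [← h1, ← h3]

end Structures

/-! ### Quaternionic representations -/

section TypeThree

variable {G : Type*} [Group G] [Fintype G] [DecidableEq G]

theorem tensorRank_projGroupTensor_le_of_quaternionic_form {k : ℕ} (ψ : MatRep G (Fin k ⊕ Fin k))
    (hψ : ∀ g, ∃ A C : Matrix (Fin k) (Fin k) ℂ,
      (ψ g : Matrix (Fin k ⊕ Fin k) (Fin k ⊕ Fin k) ℂ) =
        Matrix.fromBlocks A (-C.map (starRingEnd ℂ)) C (A.map (starRingEnd ℂ))) :
    tensorRank (projGroupTensor ψ) ≤ 8 * matMulRank k := by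
  choose A C h using hψ
  refine tensorRank_projGroupTensor_le ψ (fun g => (A g, C g))
    (le_antisymm ?_ ?_) (fun a b => ?_) (bilinearRankLE_quatMul k)
  · have hA : ∀ i j, (fun g => A g i j) ∈
        complexified (LinearMap.range (coeffMap fun g => (A g, C g))) := fun i j =>
      mem_complexified_range_coeffMap (fun g => (A g, C g))
        (Matrix.entryLinearMap ℝ ℂ i j ∘ₗ LinearMap.fst ℝ _ _)
    have hC : ∀ i j, (fun g => C g i j) ∈
        complexified (LinearMap.range (coeffMap fun g => (A g, C g))) := fun i j =>
      mem_complexified_range_coeffMap (fun g => (A g, C g))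
        (Matrix.entryLinearMap ℝ ℂ i j ∘ₗ LinearMap.snd ℝ _ _)
    rw [coeffSpace_le_iff]
    simp_rw [h]
    rintro (i | i) (j | j)
    · exact hA i j
    · exact Submodule.neg_mem _ (conj_mem_complexified (hC i j))
    · exact hC i j
    · exact conj_mem_complexified (hA i j)
  · have hψ := coeffSpace_le_iff.1 (le_refl (coeffSpace ψ))
    simp_rw [h] at hψ
    rintro _ ⟨f, rfl⟩
    have hf : coeffMap (fun g => (A g, C g)) f =
        coeffMap A (f ∘ₗ LinearMap.inl ℝ _ _) + coeffMap C (f ∘ₗ LinearMap.inr ℝ _ _) := by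
      ext g
      simp [coeffMap_apply, ← map_add]
    rw [hf]
    exact Submodule.add_mem _ (coeffMap_mem A (fun i j => hψ (Sum.inl i) (Sum.inl j)) _)
      (coeffMap_mem C (fun i j => hψ (Sum.inr i) (Sum.inl j)) _)
  · have hab := h (a * b)
    rw [map_mul, Units.val_mul, h a, h b, Matrix.fromBlocks_multiply] at hab
    obtain ⟨h1, -, h3, -⟩ := Matrix.fromBlocks_inj.1 hab
    simp only [quatMul]
    rw [← h1, ← h3, neg_mul, ← sub_eq_add_neg]

end TypeThree

end BscTensor

theorem propositionp {G : Type*} [Group G] [Fintype G] [DecidableEq G] {d : ℕ}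
    (φ : BscTensor.MatRep G (Fin d)) (hφ : BscTensor.IsBsc φ) :
    (BscTensor.IsTypeI φ →
      BscTensor.tensorRank (BscTensor.projGroupTensor φ) ≤ BscTensor.matMulRank d) ∧
    (BscTensor.IsTypeII φ → Even d ∧
      BscTensor.tensorRank (BscTensor.projGroupTensor φ) ≤ 3 * BscTensor.matMulRank (d / 2)) ∧
    (BscTensor.IsTypeIII φ → Even d ∧
      BscTensor.tensorRank (BscTensor.projGroupTensor φ) ≤ 8 * BscTensor.matMulRank (d / 2)) := by
  refine ⟨fun h => BscTensor.tensorRank_projGroupTensor_le_of_isReal h.1, ?_, ?_⟩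
  · rintro ⟨-, k, ψ, -, -, h⟩
    have hd : d = k + k := by simpa using h.card_eq
    refine ⟨⟨k, hd⟩, ?_⟩
    rw [BscTensor.tensorRank_projGroupTensor_congr h, show d / 2 = k by omega]
    exact BscTensor.tensorRank_projGroupTensor_directSum_conjRep_le ψ
  · rintro ⟨⟨hc, hr⟩, hirr⟩
    obtain ⟨P, hP, hPP | hPP⟩ := hirr.exists_structure hφ.1 hc
    · exact absurd (BscTensor.isReal_of_structure hP hPP) hr
    · obtain ⟨k, hk⟩ := BscTensor.even_card_of_mul_conj_eq_neg_one hPP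
      have hd : d = k + k := by simpa using hk
      obtain ⟨ψ, hψ, hform⟩ := BscTensor.exists_quaternionic_form hk hP hPP
      refine ⟨⟨k, hd⟩, ?_⟩
      rw [BscTensor.tensorRank_projGroupTensor_congr hψ, show d / 2 = k by omega]
      exact BscTensor.tensorRank_projGroupTensor_le_of_quaternionic_form ψ hform
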